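/- Let $E$ be a countable set and let $r:E\times E\to\mathbb{R}$ (negative values allowed) satisfy $\sup_{x\in E}\sum_{y\in E}|r(x,y)|<\infty$. Write $r^+=\max(r,0)$ and $r^-=\max(-r,0)$. Let $Lf(x)=\sum_{y\in E}r(x,y)\,[f(y)-f(x)]$, a bounded operator on the space of bounded functions $f:E\to\mathbb{R}$ with the supremum norm, and let $S_t=e^{tL}$, $t\ge 0$. Let $(\eta^+_t,\eta^-_t)_{t\ge0}$ be the continuous-time Markov chain on pairs $(\eta^+,\eta^-)$ of finitely supported functions $E\to\mathbb{N}_0$ (numbers of particles and antiparticles at the sites) which, for all $x,y\in E$, has the following transitions from $(\eta^+,\eta^-)$: - to $(\eta^++\delta_y-\delta_x,\ \eta^-)$ at rate $r^+(x,y)\,\eta^+(x)$, - to $(\eta^++\delta_x,\ \eta^-+\delta_y)$ at rate $r^-(x,y)\,\eta^+(x)$, - to $(\eta^+,\ \eta^-+\delta_y-\delta_x)$ at rate $r^+(x,y)\,\eta^-(x)$, - to $(\eta^++\delta_y,\ \eta^-+\delta_x)$ at rate $r^-(x,y)\,\eta^-(x)$. Then this chain almost surely does not explode, from any initial configuration,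 and for every bounded $f:E\to\mathbb{R}$, every $t\ge0$ and every $x\in E$, the random variable $\sum_{z\in E}(\eta_t^+(z)-\eta_t^-(z))f(z)$ is integrable for the chain started at $(\delta_x,0)$, and $$S_tf(x)=\mathbb{E}_{(\delta_x,0)}\Big[\sum_{z\in E}\big(\eta_t^+(z)-\eta_t^-(z)\big)f(z)\Big].$$ -/

import Mathlib

open MeasureTheory ProbabilityTheory
open scoped ENNReal NNReal

noncomputable section

namespace SignedRates

/-! ### The operator `L` with signed rates and its semigroup -/

/-- `sup_x ∑_y |r(x,y)| < ∞` (the sums are taken in `[0, ∞]`). -/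
def BoundedRowSums {E : Type*} (r : E → E → ℝ) : Prop :=
  (⨆ x, ∑' y, ‖r x y‖ₑ) < ∞

/-- The Banach space of bounded functions `E → ℝ` with the supremum norm. -/
abbrev BddFun (E : Type*) := lp (fun _ : E => ℝ) ∞

/-- `L f (x) = ∑_y r(x,y) (f(y) - f(x))`. -/
def genFun {E : Type*} (r : E → E → ℝ) (f : E → ℝ) (x : E) : ℝ :=
  ∑' y, r x y * (f y - f x)

/-- The row-sum norm `sup_x ∑_y |r(x,y)|` as a real number. -/
def rowBound {E : Type*} (r : E → E → ℝ) : ℝ := (⨆ x, ∑' y, ‖r x y‖ₑ).toReal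

lemma BoundedRowSums.summable {E : Type*} {r : E → E → ℝ} (hr : BoundedRowSums r) (x : E) :
    Summable fun y => ‖r x y‖ := by
  have h : (∑' y, ‖r x y‖ₑ) ≠ ∞ :=
    ((le_iSup (fun x => ∑' y, ‖r x y‖ₑ) x).trans_lt hr).ne
  simpa using ENNReal.summable_toReal h

lemma BoundedRowSums.tsum_le {E : Type*} {r : E → E → ℝ} (hr : BoundedRowSums r) (x : E) :
    ∑' y, ‖r x y‖ ≤ rowBound r := by
  have h := ENNReal.toReal_mono hr.ne (le_iSup (fun x => ∑' y, ‖r x y‖ₑ) x)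
  rw [ENNReal.tsum_toReal_eq (fun y => by simp)] at h
  simpa [rowBound] using h

lemma BoundedRowSums.norm_term_le {E : Type*} (r : E → E → ℝ) (f : BddFun E) (x y : E) :
    ‖r x y * (f y - f x)‖ ≤ ‖r x y‖ * (2 * ‖f‖) := by
  rw [norm_mul]
  gcongr
  have h1 := lp.norm_apply_le_norm ENNReal.top_ne_zero f y
  have h2 := lp.norm_apply_le_norm ENNReal.top_ne_zero f x
  linarith [norm_sub_le (f y) (f x)]

lemma BoundedRowSums.summable_term {E : Type*} {r : E → E → ℝ} (hr : BoundedRowSums r)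
    (f : BddFun E) (x : E) : Summable fun y => r x y * (f y - f x) :=
  Summable.of_norm_bounded ((hr.summable x).mul_right _) (BoundedRowSums.norm_term_le r f x)

lemma BoundedRowSums.norm_genFun_le {E : Type*} {r : E → E → ℝ} (hr : BoundedRowSums r)
    (f : BddFun E) (x : E) : ‖genFun r f x‖ ≤ 2 * rowBound r * ‖f‖ := by
  have h := tsum_of_norm_bounded ((hr.summable x).mul_right (2 * ‖f‖)).hasSum
    (BoundedRowSums.norm_term_le r f x)
  rw [tsum_mul_right] at h
  have h2 := mul_le_mul_of_nonneg_right (hr.tsum_le x) (by positivity : 0 ≤ 2 * ‖f‖)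
  calc ‖genFun r f x‖ ≤ _ := h
    _ ≤ _ := h2
    _ = _ := by ring

/-- `L` as a bounded operator on the bounded functions. -/
def gen {E : Type*} (r : E → E → ℝ) (hr : BoundedRowSums r) : BddFun E →L[ℝ] BddFun E :=
  LinearMap.mkContinuous
    { toFun := fun f => ⟨genFun r f, memℓp_infty
        ⟨2 * rowBound r * ‖f‖, by rintro _ ⟨x, rfl⟩; exact hr.norm_genFun_le f x⟩⟩
      map_add' := by
        intro f g
        ext x
        change genFun r (f + g) x = genFun r f x + genFun r g x
        unfold genFun
        rw [← (hr.summable_term f x).tsum_add (hr.summable_term g x)]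
        congr 1
        ext y
        simp only [Pi.add_apply]
        ring
      map_smul' := by
        intro a f
        ext x
        change genFun r (a • f) x = a * genFun r f x
        unfold genFun
        rw [← tsum_mul_left]
        congr 1
        ext y
        simp only [Pi.smul_apply, smul_eq_mul]
        ring }
    (2 * rowBound r)
    (fun f => lp.norm_le_of_forall_le
      (mul_nonneg (mul_nonneg zero_le_two ENNReal.toReal_nonneg) (norm_nonneg f))
      (fun x => hr.norm_genFun_le f x))

/-- The semigroup `S_t = e^{tL}` on the bounded functions. -/
def semigroup {E : Type*} (r : E → E → ℝ) (hr : BoundedRowSums r) (t : ℝ≥0) :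
    BddFun E →L[ℝ] BddFun E :=
  NormedSpace.exp ((t : ℝ) • gen r hr)

/-! ### The branching system of particles and antiparticles -/

/-- Finite configurations `(η⁺, η⁻)` of particles and antiparticles on `E`. -/
@[ext] structure Config (E : Type*) where
  /-- `pos x` is the number of particles at `x`. -/
  pos : E →₀ ℕ
  /-- `neg x` is the number of antiparticles at `x`. -/
  neg : E →₀ ℕ

/-- The configuration space carries the discrete `σ`-algebra. -/
instance (E : Type*) : MeasurableSpace (Config E) := ⊤

/-- `δ_x` -/
abbrev δ {E : Type*} (x : E) : E →₀ ℕ := Finsupp.single x 1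

/-- `r⁺ = max(r, 0)`, as an element of `[0, ∞]`. -/
def rPos {E : Type*} (r : E → E → ℝ) (x y : E) : ℝ≥0∞ := ENNReal.ofReal (max (r x y) 0)

/-- `r⁻ = max(-r, 0)`, as an element of `[0, ∞]`. -/
def rNeg {E : Type*} (r : E → E → ℝ) (x y : E) : ℝ≥0∞ := ENNReal.ofReal (max (-r x y) 0)

/-- The jump rates of the system: `jumpRate r c` is the measure on configurations that gives to
`A` the total rate of the transitions from `c = (η⁺, η⁻)` into `A`. The four terms are: motion of a
particle, branching of a particle, motion of an antiparticle, branching of an antiparticle. The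
generator of the system is `F ↦ (c ↦ ∫ (F c' - F c) (jumpRate r c)(dc'))`. -/
def jumpRate {E : Type*} (r : E → E → ℝ) (c : Config E) : Measure (Config E) :=
  Measure.sum fun p : E × E =>
    (rPos r p.1 p.2 * c.pos p.1) • Measure.dirac (⟨c.pos + δ p.2 - δ p.1, c.neg⟩ : Config E)
    + (rNeg r p.1 p.2 * c.pos p.1) • Measure.dirac (⟨c.pos + δ p.1, c.neg + δ p.2⟩ : Config E)
    + (rPos r p.1 p.2 * c.neg p.1) • Measure.dirac (⟨c.pos, c.neg + δ p.2 - δ p.1⟩ : Config E)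
    + (rNeg r p.1 p.2 * c.neg p.1) • Measure.dirac (⟨c.pos + δ p.2, c.neg + δ p.1⟩ : Config E)

/-- The total rate at which the system leaves the configuration `c`. -/
def totalRate {E : Type*} (r : E → E → ℝ) (c : Config E) : ℝ≥0∞ := jumpRate r c Set.univ

open Classical in
/-- The law of the configuration after a jump out of `c`: the normalized jump rates. (If the total
rate is `0`, the system stays at `c`; total rate `∞` does not occur for bounded row sums.) -/
def jumpProb {E : Type*} (r : E → E → ℝ) (c : Config E) : Measure (Config E) :=
  if totalRate r c = 0 ∨ totalRate r c = ∞ then Measure.dirac c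
  else (totalRate r c)⁻¹ • jumpRate r c

instance {E : Type*} (r : E → E → ℝ) (c : Config E) : IsProbabilityMeasure (jumpProb r c) := by
  unfold jumpProb
  split_ifs with h
  · infer_instance
  · push Not at h
    exact ⟨by
      simp only [Measure.smul_apply, smul_eq_mul]
      exact ENNReal.inv_mul_cancel h.1 h.2⟩

/-- One step of the jump chain, as a transition kernel. -/
def jumpKernel {E : Type*} (r : E → E → ℝ) : Kernel (Config E) (Config E) :=
  ⟨jumpProb r, measurable_from_top⟩

instance {E : Type*} (r : E → E → ℝ) : IsMarkovKernel (jumpKernel r) :=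
  ⟨fun c => inferInstanceAs (IsProbabilityMeasure (jumpProb r c))⟩

/-- The same step, given the history of the jump chain up to time `n`. -/
def historyKernel {E : Type*} (r : E → E → ℝ) (n : ℕ) :
    Kernel ((i : Finset.Iic n) → Config E) (Config E) :=
  (jumpKernel r).comap (fun h => h ⟨n, Finset.mem_Iic.2 le_rfl⟩) (measurable_pi_apply _)

instance {E : Type*} (r : E → E → ℝ) (n : ℕ) : IsMarkovKernel (historyKernel r n) := by
  unfold historyKernel
  infer_instance

/-- The law of the jump chain `(Y_n)` started at `c`: the Markov chain with transition kernel
`jumpKernel r`. -/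
def chainLaw {E : Type*} (r : E → E → ℝ) (c : Config E) : Measure (ℕ → Config E) :=
  Kernel.trajMeasure (X := fun _ => Config E) (Measure.dirac c) (historyKernel r)

/-- The sample space of the system: the jump chain `(Y_n)` and a sequence `(T_n)` of clocks. -/
abbrev Path (E : Type*) := (ℕ → Config E) × (ℕ → ℝ)

/-- The law `P_c` of the system started at `c`: the jump chain started at `c`, and independently of
it i.i.d. exponential clocks with parameter `1`. -/
def law {E : Type*} (r : E → E → ℝ) (c : Config E) : Measure (Path E) :=
  (chainLaw r c).prod (Measure.infinitePi fun _ : ℕ => expMeasure 1)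

/-- The time of the `n`-th jump, `J_n = ∑_{k<n} T_k / q(Y_k)` with `q` the total rate: given the
jump chain, the holding times are independent, and the one at `Y_k` is exponential with rate
`q(Y_k)` (infinite if `q(Y_k) = 0`). -/
def jumpTime {E : Type*} (r : E → E → ℝ) (n : ℕ) (ω : Path E) : ℝ≥0∞ :=
  ∑ k ∈ Finset.range n, ENNReal.ofReal (ω.2 k) / totalRate r (ω.1 k)

open Classical in
/-- The configuration at time `t`, namely `Y_n` if `J_n ≤ t < J_{n+1}`. (The empty configuration
after an explosion.) -/
def config {E : Type*} (r : E → E → ℝ) (t : ℝ≥0) (ω : Path E) : Config E :=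
  if h : ∃ n, (t : ℝ≥0∞) < jumpTime r (n + 1) ω then ω.1 (Nat.find h) else ⟨0, 0⟩

/-- `f↑(η⁺, η⁻) = ∑_x (η⁺(x) - η⁻(x)) f(x)` (a finite sum). -/
def lift {E : Type*} (f : E → ℝ) (c : Config E) : ℝ :=
  ∑ᶠ x, ((c.pos x : ℝ) - (c.neg x : ℝ)) * f x

end SignedRates

end

noncomputable section

namespace SignedRates

/-! ### Configurations and the functionals `lift f` -/

variable {E : Type*}

/-! A particle moving from `x` to `y` changes `lift g` by `g y - g x`, at rate `r⁺(x,y)`; a particle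
branching changes it by `g x - g y`, at rate `r⁻(x,y)`. Antiparticles contribute the opposite
changes. So the generator of the system sends `lift g` to `lift (L g)` (`integral_jumpRate_lift`),
and `lift (e^{(t-s)L} f)` evaluated at the configuration at time `s` is formally a martingale on
`[0, t]`. It starts at `S_t f(x)` and ends at `lift f` of the configuration at time `t`.

The rigorous version follows the jump chain. `remaining` is this quantity at a jump time not later
than `t`; `realized` is the final value when `t` falls before the next jump. Integrating over one
exponential holding time shows that `remaining` equals the mean of what is realized before the next
jump plus what remains after it (`remaining_eq_integral`). The Markov property
(`map_state_nextStep`) carries this to the path law (`integral_remaining_step`), and the resulting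
identities telescope.

Both passages to the limit rest on one estimate. A jump adds at most two individuals, so the exit
rate after `n` jumps is at most linear in `n`, and Chernoff's bound gives `P(J_n ≤ t) = O(n⁻³)`
(`exists_law_jumpTime_le`). This excludes explosion. Multiplied by the `O(n)` population size it
gives `L¹` bounds of order `n⁻²`: the remainder vanishes and the realized parts are absolutely
summable. -/

instance [Countable E] : Countable (Config E) :=
  Function.Injective.countable (f := fun c : Config E => (c.pos, c.neg)) fun a b h => by
    ext1
    · exact congrArg Prod.fst h
    · exact congrArg Prod.snd h

instance : DiscreteMeasurableSpace (Config E) := ⟨fun _ => trivial⟩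

/-- The total number of particles and antiparticles. -/
def card (c : Config E) : ℕ := c.pos.degree + c.neg.degree

/-- The total number of particles and antiparticles at `x`. -/
def occ (c : Config E) (x : E) : ℕ := c.pos x + c.neg x

lemma lift_eq_sum (f : E → ℝ) (c : Config E) {s : Finset E} (h₁ : c.pos.support ⊆ s)
    (h₂ : c.neg.support ⊆ s) :
    lift f c = ∑ x ∈ s, ((c.pos x : ℝ) - (c.neg x : ℝ)) * f x := by
  refine finsum_eq_sum_of_support_subset _ fun x hx => ?_
  by_contra h
  have e₁ : c.pos x = 0 := Finsupp.notMem_support_iff.1 fun h' => h (h₁ h')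
  have e₂ : c.neg x = 0 := Finsupp.notMem_support_iff.1 fun h' => h (h₂ h')
  simp [e₁, e₂] at hx

/-- `Finsupp.weight f` is additive in the configuration, so the effect of a transition on `lift f`
can be read off from this form. -/
lemma lift_eq_weight (f : E → ℝ) (c : Config E) :
    lift f c = Finsupp.weight f c.pos - Finsupp.weight f c.neg := by
  classical
  rw [lift_eq_sum f c Finset.subset_union_left Finset.subset_union_right,
    Finsupp.weight_apply, Finsupp.weight_apply,
    Finsupp.sum_of_support_subset _ (Finset.subset_union_left (s₂ := c.neg.support)) _ (by simp),
    Finsupp.sum_of_support_subset _ (Finset.subset_union_right (s₁ := c.pos.support)) _ (by simp),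
    ← Finset.sum_sub_distrib]
  simp [sub_mul]

lemma lift_add (f g : E → ℝ) (c : Config E) : lift (f + g) c = lift f c + lift g c := by
  classical
  have h₁ := Finset.subset_union_left (s₁ := c.pos.support) (s₂ := c.neg.support)
  have h₂ := Finset.subset_union_right (s₁ := c.pos.support) (s₂ := c.neg.support)
  rw [lift_eq_sum _ c h₁ h₂, lift_eq_sum _ c h₁ h₂, lift_eq_sum _ c h₁ h₂,
    ← Finset.sum_add_distrib]
  simp [mul_add]

lemma lift_smul (a : ℝ) (f : E → ℝ) (c : Config E) : lift (a • f) c = a * lift f c := by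
  classical
  have h₁ := Finset.subset_union_left (s₁ := c.pos.support) (s₂ := c.neg.support)
  have h₂ := Finset.subset_union_right (s₁ := c.pos.support) (s₂ := c.neg.support)
  rw [lift_eq_sum _ c h₁ h₂, lift_eq_sum _ c h₁ h₂, Finset.mul_sum]
  refine Finset.sum_congr rfl fun x _ => ?_
  simp only [Pi.smul_apply, smul_eq_mul]
  ring

lemma abs_weight_le {f : E → ℝ} {B : ℝ} (hf : ∀ x, |f x| ≤ B) (η : E →₀ ℕ) :
    |Finsupp.weight f η| ≤ B * η.degree := by
  rw [Finsupp.weight_apply, Finsupp.sum, Finsupp.degree_apply, Nat.cast_sum, Finset.mul_sum]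
  refine (Finset.abs_sum_le_sum_abs _ _).trans (Finset.sum_le_sum fun x _ => ?_)
  rw [nsmul_eq_mul, abs_mul, Nat.abs_cast, mul_comm]
  gcongr
  exact hf x

lemma abs_lift_le {f : E → ℝ} {B : ℝ} (hf : ∀ x, |f x| ≤ B) (c : Config E) :
    |lift f c| ≤ B * card c := by
  rw [lift_eq_weight, card, Nat.cast_add, mul_add]
  exact (abs_sub _ _).trans (add_le_add (abs_weight_le hf _) (abs_weight_le hf _))

lemma BddFun.abs_apply_le (f : BddFun E) (x : E) : |f x| ≤ ‖f‖ :=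
  lp.norm_apply_le_norm ENNReal.top_ne_zero f x

/-- `f ↦ lift f c` as a continuous linear functional. -/
def liftCLM (c : Config E) : BddFun E →L[ℝ] ℝ :=
  LinearMap.mkContinuous
    { toFun := fun f => lift f c
      map_add' := fun f g => lift_add f g c
      map_smul' := fun a f => lift_smul a f c }
    (card c)
    fun f => by
      rw [mul_comm]
      exact abs_lift_le (BddFun.abs_apply_le f) c

/-- Subtraction of `ℕ`-valued functions is truncated; an occupied site `x` makes it a genuine
subtraction. -/
lemma weight_move (f : E → ℝ) (η : E →₀ ℕ) {x : E} (y : E) (h : η x ≠ 0) :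
    Finsupp.weight f (η + δ y - δ x) = Finsupp.weight f η + f y - f x := by
  have hle : δ x ≤ η + δ y := by
    rw [Finsupp.single_le_iff, Finsupp.add_apply]
    omega
  have e := congrArg (Finsupp.weight f) (tsub_add_cancel_of_le hle)
  simp only [map_add, Finsupp.weight_single, one_smul] at e
  linarith

lemma degree_move (η : E →₀ ℕ) {x : E} (y : E) (h : η x ≠ 0) :
    (η + δ y - δ x).degree = η.degree := by
  have hle : δ x ≤ η + δ y := by
    rw [Finsupp.single_le_iff, Finsupp.add_apply]
    omega
  have e := congrArg Finsupp.degree (tsub_add_cancel_of_le hle)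
  simp only [map_add, Finsupp.degree_single] at e
  omega

/-! ### The jump rates -/

lemma rPos_ne_top (r : E → E → ℝ) (x y : E) : rPos r x y ≠ ∞ := ENNReal.ofReal_ne_top

lemma rNeg_ne_top (r : E → E → ℝ) (x y : E) : rNeg r x y ≠ ∞ := ENNReal.ofReal_ne_top

lemma rPos_add_rNeg (r : E → E → ℝ) (x y : E) : rPos r x y + rNeg r x y = ‖r x y‖ₑ := by
  rw [rPos, rNeg, ← ENNReal.ofReal_add (le_max_right _ _) (le_max_right _ _),
    ← ofReal_norm, Real.norm_eq_abs]
  congr 1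
  rcases le_total 0 (r x y) with h | h
  · rw [max_eq_left h, max_eq_right (by linarith), abs_of_nonneg h, add_zero]
  · rw [max_eq_right h, max_eq_left (by linarith), abs_of_nonpos h, zero_add]

lemma toReal_rPos_sub_rNeg (r : E → E → ℝ) (x y : E) :
    (rPos r x y).toReal - (rNeg r x y).toReal = r x y := by
  rw [rPos, rNeg, ENNReal.toReal_ofReal (le_max_right _ _),
    ENNReal.toReal_ofReal (le_max_right _ _)]
  rcases le_total 0 (r x y) with h | h
  · rw [max_eq_left h, max_eq_right (by linarith), sub_zero]
  · rw [max_eq_right h, max_eq_left (by linarith)]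
    ring

lemma toReal_rPos_add_rNeg (r : E → E → ℝ) (x y : E) :
    (rPos r x y).toReal + (rNeg r x y).toReal = |r x y| := by
  rw [← ENNReal.toReal_add (rPos_ne_top r x y) (rNeg_ne_top r x y), rPos_add_rNeg, toReal_enorm,
    Real.norm_eq_abs]

/-- The part of the jump rates that comes from the pair of sites `p`. -/
def pairRate (r : E → E → ℝ) (c : Config E) (p : E × E) : Measure (Config E) :=
  (rPos r p.1 p.2 * c.pos p.1) • Measure.dirac (⟨c.pos + δ p.2 - δ p.1, c.neg⟩ : Config E)
    + (rNeg r p.1 p.2 * c.pos p.1) • Measure.dirac (⟨c.pos + δ p.1, c.neg + δ p.2⟩ : Config E)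
    + (rPos r p.1 p.2 * c.neg p.1) • Measure.dirac (⟨c.pos, c.neg + δ p.2 - δ p.1⟩ : Config E)
    + (rNeg r p.1 p.2 * c.neg p.1) • Measure.dirac (⟨c.pos + δ p.2, c.neg + δ p.1⟩ : Config E)

lemma jumpRate_eq_sum (r : E → E → ℝ) (c : Config E) :
    jumpRate r c = Measure.sum (pairRate r c) := rfl

lemma pairRate_univ (r : E → E → ℝ) (c : Config E) (p : E × E) :
    pairRate r c p Set.univ = ‖r p.1 p.2‖ₑ * occ c p.1 := by
  simp only [pairRate, Measure.add_apply, Measure.smul_apply, measure_univ, smul_eq_mul, mul_one,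
    occ, Nat.cast_add, ← rPos_add_rNeg]
  ring

lemma totalRate_eq_tsum (r : E → E → ℝ) (c : Config E) :
    totalRate r c = ∑' p : E × E, ‖r p.1 p.2‖ₑ * occ c p.1 := by
  rw [totalRate, jumpRate_eq_sum, Measure.sum_apply _ MeasurableSet.univ]
  simp_rw [pairRate_univ]

lemma tsum_occ (c : Config E) : ∑' x, (occ c x : ℝ≥0∞) = card c := by
  have key : ∀ η : E →₀ ℕ, ∑' x, (η x : ℝ≥0∞) = η.degree := fun η => by
    rw [Finsupp.degree_apply, Nat.cast_sum]
    exact tsum_eq_sum fun x hx => by simpa using hx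
  simp only [occ, Nat.cast_add, card]
  rw [ENNReal.tsum_add, key, key]

/-- Each individual at `x`, of either sign, contributes the row sum `∑_y |r(x,y)|`. -/
lemma totalRate_le {r : E → E → ℝ} (hr : BoundedRowSums r) (c : Config E) :
    totalRate r c ≤ ENNReal.ofReal (rowBound r) * card c := by
  rw [totalRate_eq_tsum, ENNReal.tsum_prod', rowBound, ENNReal.ofReal_toReal hr.ne, ← tsum_occ,
    ← ENNReal.tsum_mul_left]
  refine ENNReal.tsum_le_tsum fun x => ?_
  simp only
  rw [ENNReal.tsum_mul_right]
  gcongr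
  exact le_iSup (fun x => ∑' y, ‖r x y‖ₑ) x

lemma totalRate_ne_top {r : E → E → ℝ} (hr : BoundedRowSums r) (c : Config E) :
    totalRate r c ≠ ∞ :=
  ((totalRate_le hr c).trans_lt
    (ENNReal.mul_lt_top ENNReal.ofReal_lt_top (ENNReal.natCast_lt_top _))).ne

lemma isFiniteMeasure_jumpRate {r : E → E → ℝ} (hr : BoundedRowSums r) (c : Config E) :
    IsFiniteMeasure (jumpRate r c) :=
  ⟨(totalRate_ne_top hr c).lt_top⟩

/-- Targets of transitions with rate zero may be ignored. This discards moves out of an empty site,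
whose formal target is spoiled by truncated subtraction. -/
lemma ae_smul_dirac {p : Config E → Prop} {a : ℝ≥0∞} {c : Config E} (h : a ≠ 0 → p c) :
    ∀ᵐ c' ∂(a • Measure.dirac c), p c' := by
  by_cases ha : a = 0
  · simp [ha]
  · exact Measure.ae_smul_measure (by simpa [ae_dirac_eq] using h ha) _

/-- Moves preserve the population size and branchings raise it by two. -/
lemma ae_jumpRate_card_le [Countable E] (r : E → E → ℝ) (c : Config E) :
    ∀ᵐ c' ∂(jumpRate r c), card c' ≤ card c + 2 := by
  rw [jumpRate_eq_sum, Measure.ae_sum_iff]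
  intro p
  simp only [pairRate, ae_add_measure_iff]
  refine ⟨⟨⟨ae_smul_dirac fun h => ?_, ae_smul_dirac fun _ => ?_⟩, ae_smul_dirac fun h => ?_⟩,
    ae_smul_dirac fun _ => ?_⟩
  · have h' : c.pos p.1 ≠ 0 := fun e => h (by simp [e])
    simp only [card, degree_move _ _ h']
    omega
  · simp only [card, map_add, Finsupp.degree_single]
    omega
  · have h' : c.neg p.1 ≠ 0 := fun e => h (by simp [e])
    simp only [card, degree_move _ _ h']
    omega
  · simp only [card, map_add, Finsupp.degree_single]
    omega

lemma ae_jumpProb_card_le [Countable E] (r : E → E → ℝ) (c : Config E) :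
    ∀ᵐ c' ∂(jumpProb r c), card c' ≤ card c + 2 := by
  unfold jumpProb
  split_ifs with h
  · rw [ae_dirac_iff (MeasurableSet.of_discrete)]
    omega
  · exact Measure.ae_smul_measure (ae_jumpRate_card_le r c) _

lemma integrable_lift_of_ae_card_le [Countable E] {μ : Measure (Config E)} [IsFiniteMeasure μ]
    {k : ℕ} (h : ∀ᵐ c ∂μ, card c ≤ k) (g : BddFun E) : Integrable (fun c => lift g c) μ := by
  refine Integrable.of_bound Measurable.of_discrete.aestronglyMeasurable (‖g‖ * k) ?_
  filter_upwards [h] with c hc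
  refine (abs_lift_le (BddFun.abs_apply_le g) c).trans ?_
  gcongr

/-- The first term is the pair's total rate times the old value. In the increments the rates combine
to `r⁺ - r⁻ = r`, with opposite signs for particles and antiparticles. -/
lemma integral_pairRate_lift (r : E → E → ℝ) (c : Config E) (g : E → ℝ) (p : E × E) :
    ∫ c', lift g c' ∂(pairRate r c p) = |r p.1 p.2| * occ c p.1 * lift g c +
      ((c.pos p.1 : ℝ) - c.neg p.1) * (r p.1 p.2 * (g p.2 - g p.1)) := by
  have hi : ∀ (a : ℝ≥0∞) (c' : Config E), a ≠ ∞ →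
      Integrable (fun c => lift g c) (a • Measure.dirac c') := fun a c' ha =>
    (integrable_dirac (by simp)).smul_measure ha
  have hp : ∀ k : ℕ, rPos r p.1 p.2 * k ≠ ∞ := fun k =>
    ENNReal.mul_ne_top (rPos_ne_top r _ _) (ENNReal.natCast_ne_top k)
  have hn : ∀ k : ℕ, rNeg r p.1 p.2 * k ≠ ∞ := fun k =>
    ENNReal.mul_ne_top (rNeg_ne_top r _ _) (ENNReal.natCast_ne_top k)
  rw [pairRate, integral_add_measure
      (((hi _ _ (hp _)).add_measure (hi _ _ (hn _))).add_measure (hi _ _ (hp _))) (hi _ _ (hn _)),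
    integral_add_measure ((hi _ _ (hp _)).add_measure (hi _ _ (hn _))) (hi _ _ (hp _)),
    integral_add_measure (hi _ _ (hp _)) (hi _ _ (hn _))]
  simp only [integral_smul_measure, integral_dirac, ENNReal.toReal_mul, ENNReal.toReal_natCast,
    smul_eq_mul]
  -- The occupation number is kept as a factor, so that the identity also holds at an empty site.
  have e₁ : (c.pos p.1 : ℝ) * lift g ⟨c.pos + δ p.2 - δ p.1, c.neg⟩ =
      c.pos p.1 * (lift g c + g p.2 - g p.1) := by
    by_cases h : c.pos p.1 = 0
    · simp [h]
    · rw [lift_eq_weight, lift_eq_weight, weight_move g c.pos p.2 h]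
      ring
  have e₂ : (c.neg p.1 : ℝ) * lift g ⟨c.pos, c.neg + δ p.2 - δ p.1⟩ =
      c.neg p.1 * (lift g c - g p.2 + g p.1) := by
    by_cases h : c.neg p.1 = 0
    · simp [h]
    · rw [lift_eq_weight, lift_eq_weight, weight_move g c.neg p.2 h]
      ring
  have e₃ : ∀ x y, lift g ⟨c.pos + δ x, c.neg + δ y⟩ = lift g c + g x - g y := fun x y => by
    simp only [lift_eq_weight, map_add, Finsupp.weight_single, one_smul]
    ring
  rw [mul_assoc, e₁, mul_assoc (rPos r p.1 p.2).toReal, e₂, e₃, e₃, ← toReal_rPos_add_rNeg, occ,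
    Nat.cast_add]
  have e₄ := toReal_rPos_sub_rNeg r p.1 p.2
  rw [← e₄]
  ring

/-- The generator of the particle system maps `lift g` to `lift (L g)`. -/
lemma integral_jumpRate_lift [Countable E] {r : E → E → ℝ} (hr : BoundedRowSums r) (c : Config E)
    (g : BddFun E) :
    ∫ c', lift g c' ∂(jumpRate r c) =
      (totalRate r c).toReal * lift g c + lift (genFun r g) c := by
  have := isFiniteMeasure_jumpRate hr c
  have h : HasSum (fun p => ∫ c', lift g c' ∂(pairRate r c p)) (∫ c', lift g c' ∂(jumpRate r c)) :=
    hasSum_integral_measure (integrable_lift_of_ae_card_le (ae_jumpRate_card_le r c) g)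
  simp_rw [integral_pairRate_lift] at h
  have hq : HasSum (fun p : E × E => |r p.1 p.2| * occ c p.1 * lift g c)
      ((totalRate r c).toReal * lift g c) := by
    refine HasSum.mul_right _ ?_
    have ht := totalRate_ne_top hr c
    rw [totalRate_eq_tsum] at ht ⊢
    rw [ENNReal.tsum_toReal_eq (ENNReal.ne_top_of_tsum_ne_top ht)]
    simpa using (ENNReal.summable_toReal ht).hasSum
  -- After removing the total rate term, summing over `y` first turns the increments into `genFun r
  -- g`.
  have hd := h.sub hq
  simp only [add_sub_cancel_left] at hd
  have hfib : HasSum (fun x => ((c.pos x : ℝ) - c.neg x) * genFun r g x)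
      (∫ c', lift g c' ∂(jumpRate r c) - (totalRate r c).toReal * lift g c) :=
    hd.prod_fiberwise fun x => (hr.summable_term g x).hasSum.mul_left _
  have hl : HasSum (fun x => ((c.pos x : ℝ) - c.neg x) * genFun r g x) (lift (genFun r g) c) := by
    classical
    rw [lift_eq_sum _ c Finset.subset_union_left Finset.subset_union_right]
    refine hasSum_sum_of_ne_finset_zero fun x hx => ?_
    simp only [Finset.mem_union, Finsupp.mem_support_iff, not_or, not_not] at hx
    simp [hx]
  linarith [hfib.unique hl]

/-! ### The semigroup -/

/-- `e^{sL} f` for real `s`. -/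
def evol (r : E → E → ℝ) (hr : BoundedRowSums r) (f : BddFun E) (s : ℝ) : BddFun E :=
  NormedSpace.exp (s • gen r hr) f

/-- `lift (e^{sL} f) c`. -/
def value (r : E → E → ℝ) (hr : BoundedRowSums r) (f : BddFun E) (s : ℝ) (c : Config E) : ℝ :=
  lift (evol r hr f s) c

lemma evol_zero (r : E → E → ℝ) (hr : BoundedRowSums r) (f : BddFun E) : evol r hr f 0 = f := by
  rw [evol, show (0 : ℝ) • gen r hr = 0 from
    ContinuousLinearMap.ext fun g => zero_smul ℝ (gen r hr g), NormedSpace.exp_zero]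
  rfl

lemma hasDerivAt_evol (r : E → E → ℝ) (hr : BoundedRowSums r) (f : BddFun E) (s : ℝ) :
    HasDerivAt (evol r hr f) (gen r hr (evol r hr f s)) s := by
  have h := (hasDerivAt_exp_smul_const' (𝕂 := ℝ) (gen r hr) s).clm_apply (hasDerivAt_const s f)
  exact h.congr_deriv (by simp [evol])

lemma continuous_evol (r : E → E → ℝ) (hr : BoundedRowSums r) (f : BddFun E) :
    Continuous (evol r hr f) :=
  continuous_iff_continuousAt.2 fun s => (hasDerivAt_evol r hr f s).continuousAt

lemma exists_norm_evol_le (r : E → E → ℝ) (hr : BoundedRowSums r) (f : BddFun E) (t : ℝ) :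
    ∃ C, 0 ≤ C ∧ ∀ s ∈ Set.Icc 0 t, ‖evol r hr f s‖ ≤ C := by
  obtain ⟨C, hC⟩ := (isCompact_Icc (a := (0 : ℝ)) (b := t)).exists_bound_of_continuousOn
    (continuous_evol r hr f).continuousOn
  exact ⟨max C 0, le_max_right _ _, fun s hs => (hC s hs).trans (le_max_left _ _)⟩

lemma value_zero (r : E → E → ℝ) (hr : BoundedRowSums r) (f : BddFun E) (c : Config E) :
    value r hr f 0 c = lift f c := by
  rw [value, evol_zero]

lemma hasDerivAt_value (r : E → E → ℝ) (hr : BoundedRowSums r) (f : BddFun E) (c : Config E)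
    (s : ℝ) :
    HasDerivAt (fun s => value r hr f s c) (liftCLM c (gen r hr (evol r hr f s))) s :=
  (liftCLM c).hasFDerivAt.comp_hasDerivAt s (hasDerivAt_evol r hr f s)

lemma continuous_value (r : E → E → ℝ) (hr : BoundedRowSums r) (f : BddFun E) (c : Config E) :
    Continuous fun s => value r hr f s c :=
  (liftCLM c).continuous.comp (continuous_evol r hr f)

lemma integral_jumpRate_value [Countable E] (r : E → E → ℝ) (hr : BoundedRowSums r)
    (f : BddFun E) (c : Config E) (s : ℝ) :
    ∫ c', value r hr f s c' ∂(jumpRate r c) =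
      (totalRate r c).toReal * value r hr f s c + liftCLM c (gen r hr (evol r hr f s)) :=
  integral_jumpRate_lift hr c (evol r hr f s)

/-! ### The first-step equation -/

/-- The value at a configuration `c` that is entered at time `j`, with horizon `t`. -/
def remaining (r : E → E → ℝ) (hr : BoundedRowSums r) (f : BddFun E) (t : ℝ≥0) (c : Config E)
    (j : ℝ≥0∞) : ℝ :=
  if j ≤ t then value r hr f (t - j.toReal) c else 0

/-- The value of a configuration `c` that is occupied at time `t`, if it is during `[j, j')`. -/
def realized (f : E → ℝ) (t : ℝ≥0) (c : Config E) (j j' : ℝ≥0∞) : ℝ :=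
  if j ≤ t ∧ t < j' then lift f c else 0

lemma expMeasure_one_eq : expMeasure 1 = volume.withDensity (exponentialPDF 1) := rfl

lemma measurable_exponentialPDF_one : Measurable (exponentialPDF 1) :=
  (measurable_exponentialPDFReal 1).ennreal_ofReal

lemma integral_expMeasure (φ : ℝ → ℝ) :
    ∫ τ, φ τ ∂(expMeasure 1) = ∫ τ in Set.Ioi 0, Real.exp (-τ) * φ τ := by
  rw [expMeasure_one_eq, integral_withDensity_eq_integral_toReal_smul
    measurable_exponentialPDF_one (ae_of_all _ fun _ => ENNReal.ofReal_lt_top),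
    ← integral_Ici_eq_integral_Ioi, ← integral_indicator measurableSet_Ici]
  congr 1
  ext τ
  rw [exponentialPDF_eq]
  by_cases h : 0 ≤ τ
  · rw [if_pos h, Set.indicator_of_mem (Set.mem_Ici.2 h), one_mul, one_mul,
      ENNReal.toReal_ofReal (Real.exp_nonneg _), smul_eq_mul]
  · rw [if_neg h, Set.indicator_of_notMem (by simpa using h)]
    simp

instance : IsProbabilityMeasure (expMeasure 1) := isProbabilityMeasure_expMeasure one_pos

lemma ae_expMeasure_pos : ∀ᵐ τ ∂(expMeasure 1), 0 < τ := by
  rw [expMeasure_one_eq, ae_withDensity_iff measurable_exponentialPDF_one]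
  filter_upwards [Measure.ae_ne volume (0 : ℝ)] with τ h₀ h
  by_contra hτ
  exact h (exponentialPDF_of_neg (lt_of_le_of_ne (not_lt.1 hτ) h₀))

lemma continuous_exp_mul_value (r : E → E → ℝ) (hr : BoundedRowSums r) (f : BddFun E)
    (c : Config E) (ρ s : ℝ) : Continuous fun τ => Real.exp (-τ) *
      (value r hr f (s - τ / ρ) c + liftCLM c (gen r hr (evol r hr f (s - τ / ρ))) / ρ) := by
  have hu : Continuous fun τ : ℝ => s - τ / ρ := by fun_prop
  have h₁ := (continuous_value r hr f c).comp hu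
  have h₂ := ((liftCLM c).continuous.comp
    ((gen r hr).continuous.comp (continuous_evol r hr f))).comp hu
  exact (Real.continuous_exp.comp continuous_neg).mul (h₁.add (h₂.div_const ρ))

/-- The integrand is the derivative of `-e^{-τ} value (s - τ/ρ)`. At `τ = ρ s` the time left is zero
and the value is `lift f c`. -/
lemma integral_mul_exp_value [Countable E] (r : E → E → ℝ) (hr : BoundedRowSums r) (f : BddFun E)
    (c : Config E) {ρ s : ℝ} (hρ : 0 < ρ) (hs : 0 ≤ s) :
    (∫ τ in Set.Ioc 0 (ρ * s), Real.exp (-τ) *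
      (value r hr f (s - τ / ρ) c + liftCLM c (gen r hr (evol r hr f (s - τ / ρ))) / ρ)) =
      value r hr f s c - Real.exp (-(ρ * s)) * lift f c := by
  rw [← intervalIntegral.integral_of_le (by positivity)]
  have hu : ∀ τ : ℝ, HasDerivAt (fun τ => s - τ / ρ) (-(1 / ρ)) τ := fun τ => by
    simpa using ((hasDerivAt_id τ).div_const ρ).const_sub s
  have hd : ∀ τ ∈ Set.uIcc 0 (ρ * s), HasDerivAt
      (fun τ => -(Real.exp (-τ) * value r hr f (s - τ / ρ) c)) (Real.exp (-τ) *
      (value r hr f (s - τ / ρ) c + liftCLM c (gen r hr (evol r hr f (s - τ / ρ))) / ρ)) τ := by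
    intro τ _
    have h₁ := (hasDerivAt_value r hr f c (s - τ / ρ)).comp τ (hu τ)
    have h₂ := (hasDerivAt_neg τ).exp
    convert! (h₂.mul h₁).neg using 1
    simp only [Function.comp]
    ring
  rw [intervalIntegral.integral_eq_sub_of_hasDerivAt hd
      ((continuous_exp_mul_value r hr f c ρ s).intervalIntegrable _ _),
    mul_div_cancel_left₀ _ hρ.ne', sub_self, value_zero]
  simp
  ring

/-- The value of the current configuration is the mean of its value after one jump. -/
theorem remaining_eq_integral [Countable E] (r : E → E → ℝ) (hr : BoundedRowSums r) (f : BddFun E)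
    (t : ℝ≥0) (c : Config E) (j : ℝ≥0∞) :
    remaining r hr f t c j = ∫ τ, (realized f t c j (j + ENNReal.ofReal τ / totalRate r c) +
      ∫ c', remaining r hr f t c' (j + ENNReal.ofReal τ / totalRate r c) ∂(jumpProb r c))
        ∂(expMeasure 1) := by
  by_cases hj : j ≤ t
  swap
  · have h' : ∀ j', ¬ j + j' ≤ (t : ℝ≥0∞) := fun j' h => hj (le_self_add.trans h)
    simp [remaining, realized, hj, h']
  have hjt : j ≠ ∞ := (hj.trans_lt ENNReal.coe_lt_top).ne
  have hs : 0 ≤ (t : ℝ) - j.toReal := by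
    have := ENNReal.toReal_mono ENNReal.coe_ne_top hj
    simpa using this
  rw [remaining, if_pos hj]
  set s : ℝ := t - j.toReal with hsdef
  -- At an absorbing configuration the generator identity makes the value constant in time; the next
  -- jump time is `∞`, because `a / 0 = ∞` in `ℝ≥0∞` for `a ≠ 0`.
  by_cases hq : totalRate r c = 0
  · have hd : ∀ u, liftCLM c (gen r hr (evol r hr f u)) = 0 := fun u => by
      have h := integral_jumpRate_value r hr f c u
      rw [Measure.measure_univ_eq_zero.1 hq, hq] at h
      simpa using h.symm
    have hconst : value r hr f s c = lift f c := by
      rw [← value_zero r hr f c]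
      refine is_const_of_deriv_eq_zero (f := fun u => value r hr f u c)
        (fun u => (hasDerivAt_value r hr f c u).differentiableAt) (fun u => ?_) _ _
      rw [(hasDerivAt_value r hr f c u).deriv, hd]
    have he : ∀ᵐ τ ∂(expMeasure 1), (realized f t c j (j + ENNReal.ofReal τ / totalRate r c) +
        ∫ c', remaining r hr f t c' (j + ENNReal.ofReal τ / totalRate r c) ∂(jumpProb r c)) =
        lift f c := by
      filter_upwards [ae_expMeasure_pos] with τ hτ
      rw [hq, ENNReal.div_zero (by simpa using hτ), add_top]
      simp [realized, remaining, hj]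
    rw [integral_congr_ae he, hconst]
    simp
  · set ρ : ℝ := (totalRate r c).toReal with hρdef
    have hqt := totalRate_ne_top hr c
    have hρ : 0 < ρ := ENNReal.toReal_pos hq hqt
    have hjump : ∀ u, ∫ c', value r hr f u c' ∂(jumpProb r c) =
        value r hr f u c + liftCLM c (gen r hr (evol r hr f u)) / ρ := fun u => by
      rw [jumpProb, if_neg (by simp [hq, hqt]), integral_smul_measure, integral_jumpRate_value,
        ENNReal.toReal_inv, ← hρdef, smul_eq_mul]
      field_simp
    have hle : ∀ τ : ℝ, 0 < τ →
        (j + ENNReal.ofReal τ / totalRate r c ≤ (t : ℝ≥0∞) ↔ τ ≤ ρ * s) ∧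
        (j + ENNReal.ofReal τ / totalRate r c).toReal = j.toReal + τ / ρ := fun τ hτ => by
      have h1 : (ENNReal.ofReal τ / totalRate r c) ≠ ∞ :=
        ENNReal.div_ne_top ENNReal.ofReal_ne_top hq
      have h2 : (j + ENNReal.ofReal τ / totalRate r c).toReal = j.toReal + τ / ρ := by
        rw [ENNReal.toReal_add hjt h1, ENNReal.toReal_div, ENNReal.toReal_ofReal hτ.le]
      refine ⟨?_, h2⟩
      rw [← ENNReal.toReal_le_toReal (ENNReal.add_ne_top.2 ⟨hjt, h1⟩) ENNReal.coe_ne_top, h2,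
        ENNReal.coe_toReal, ← le_sub_iff_add_le', ← hsdef, div_le_iff₀' hρ]
    -- The next jump comes no later than `t` exactly when `τ ≤ ρ s`. Below this threshold only
    -- `remaining` contributes, above it only `realized`; the latter supplies the missing `e^{-ρ s}
    -- lift f c`.
    rw [integral_expMeasure, ← Set.Ioc_union_Ioi_eq_Ioi (mul_nonneg hρ.le hs)]
    have e₁ : Set.EqOn (fun τ => Real.exp (-τ) *
        (realized f t c j (j + ENNReal.ofReal τ / totalRate r c) +
        ∫ c', remaining r hr f t c' (j + ENNReal.ofReal τ / totalRate r c) ∂(jumpProb r c)))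
        (fun τ => Real.exp (-τ) *
          (value r hr f (s - τ / ρ) c + liftCLM c (gen r hr (evol r hr f (s - τ / ρ))) / ρ))
        (Set.Ioc 0 (ρ * s)) := fun τ hτ => by
      obtain ⟨h1, h2⟩ := hle τ hτ.1
      have h3 := h1.2 hτ.2
      simp only [realized, remaining, if_pos h3, h2, not_lt.2 h3, and_false, if_false, zero_add]
      rw [← hjump, hsdef, sub_sub]
    have e₂ : Set.EqOn (fun τ => Real.exp (-τ) *
        (realized f t c j (j + ENNReal.ofReal τ / totalRate r c) +
        ∫ c', remaining r hr f t c' (j + ENNReal.ofReal τ / totalRate r c) ∂(jumpProb r c)))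
        (fun τ => Real.exp (-τ) * lift f c) (Set.Ioi (ρ * s)) := fun τ hτ => by
      have h1 := (hle τ ((mul_nonneg hρ.le hs).trans_lt hτ)).1.not.2 (not_le.2 hτ)
      simp [realized, remaining, h1, not_le.1 h1, hj]
    have i₂ : IntegrableOn (fun τ => Real.exp (-τ) * lift f c) (Set.Ioi (ρ * s)) :=
      (integrableOn_exp_neg_Ioi _).mul_const _
    have i₁ : IntegrableOn (fun τ => Real.exp (-τ) *
        (value r hr f (s - τ / ρ) c + liftCLM c (gen r hr (evol r hr f (s - τ / ρ))) / ρ))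
        (Set.Ioc 0 (ρ * s)) :=
      (continuous_exp_mul_value r hr f c ρ s).integrableOn_Ioc
    rw [setIntegral_union (Set.Ioc_disjoint_Ioi le_rfl) measurableSet_Ioi
      (i₁.congr_fun e₁.symm measurableSet_Ioc) (i₂.congr_fun e₂.symm measurableSet_Ioi),
      setIntegral_congr_fun measurableSet_Ioc e₁, setIntegral_congr_fun measurableSet_Ioi e₂,
      integral_mul_exp_value r hr f c hρ hs, integral_mul_const, integral_exp_neg_Ioi]
    ring

open Kernel in
lemma map_frestrictLe_zero_trajMeasure {X : ℕ → Type*} [∀ n, MeasurableSpace (X n)]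
    (μ₀ : Measure (X 0)) [IsProbabilityMeasure μ₀]
    (κ : (n : ℕ) → Kernel ((i : Finset.Iic n) → X i) (X (n + 1))) [∀ n, IsMarkovKernel (κ n)] :
    (trajMeasure μ₀ κ).map (Preorder.frestrictLe 0) =
      μ₀.map (MeasurableEquiv.piUnique _).symm := by
  rw [trajMeasure, Measure.map_comp _ _ (by fun_prop), traj_map_frestrictLe, partialTraj_self]
  exact Measure.id_comp

/-! ### The law of the path -/

/-- The law of the clocks. -/
abbrev clocks : Measure (ℕ → ℝ) := Measure.infinitePi fun _ : ℕ => expMeasure 1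

instance (r : E → E → ℝ) (c : Config E) : IsProbabilityMeasure (chainLaw r c) := by
  unfold chainLaw
  infer_instance

instance (r : E → E → ℝ) (c : Config E) : IsProbabilityMeasure (law r c) := by
  unfold law
  infer_instance

lemma jumpTime_succ (r : E → E → ℝ) (n : ℕ) (ω : Path E) :
    jumpTime r (n + 1) ω = jumpTime r n ω + ENNReal.ofReal (ω.2 n) / totalRate r (ω.1 n) :=
  Finset.sum_range_succ _ _

lemma jumpTime_mono (r : E → E → ℝ) (ω : Path E) : Monotone fun n => jumpTime r n ω :=
  monotone_nat_of_le_succ fun n => by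
    rw [jumpTime_succ]
    exact le_self_add

lemma measurable_totalRate [Countable E] (r : E → E → ℝ) : Measurable (totalRate r) :=
  Measurable.of_discrete

@[fun_prop]
lemma measurable_jumpTime [Countable E] (r : E → E → ℝ) (n : ℕ) : Measurable (jumpTime r n) := by
  unfold jumpTime
  refine Finset.measurable_fun_sum _ fun k _ => ?_
  have h : Measurable fun ω : Path E => totalRate r (ω.1 k) :=
    (measurable_totalRate r).comp ((measurable_pi_apply k).comp measurable_fst)
  have h' : Measurable fun ω : Path E => ENNReal.ofReal (ω.2 k) :=
    ENNReal.measurable_ofReal.comp ((measurable_pi_apply k).comp measurable_snd)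
  exact h'.div h

/-- The Markov property of the jump chain, for integrands that see the past only up to time `n`;
hypothesis `hn` says this by freezing the path after `n`. -/
lemma lintegral_chainLaw_step (r : E → E → ℝ) (c : Config E) (n : ℕ)
    {Ψ : (ℕ → Config E) → Config E → ℝ≥0∞} (hΨ : Measurable (Function.uncurry Ψ))
    (hn : ∀ y c', Ψ (fun k => y (min k n)) c' = Ψ y c') :
    ∫⁻ y, Ψ y (y (n + 1)) ∂(chainLaw r c) =
      ∫⁻ y, ∫⁻ c', Ψ y c' ∂(jumpProb r (y n)) ∂(chainLaw r c) := by
  let e : ((i : Finset.Iic n) → Config E) → ℕ → Config E := fun h k =>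
    h ⟨min k n, Finset.mem_Iic.2 (min_le_right _ _)⟩
  have he : Measurable e := measurable_pi_lambda _ fun k => measurable_pi_apply _
  have hΨe : Measurable fun p : ((i : Finset.Iic n) → Config E) × Config E => Ψ (e p.1) p.2 :=
    hΨ.comp ((he.comp measurable_fst).prodMk measurable_snd)
  have hfr : Measurable fun y : ℕ → Config E =>
      (Preorder.frestrictLe (π := fun _ => Config E) n y, y (n + 1)) := by fun_prop
  have h₁ : ∫⁻ y, Ψ y (y (n + 1)) ∂(chainLaw r c) =
      ∫⁻ p, Ψ (e p.1) p.2 ∂((chainLaw r c).map fun y =>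
        (Preorder.frestrictLe (π := fun _ => Config E) n y, y (n + 1))) := by
    rw [lintegral_map hΨe hfr]
    exact lintegral_congr fun y => (hn y _).symm
  rw [h₁, chainLaw, ← Kernel.map_frestrictLe_trajMeasure_compProd_eq_map_trajMeasure,
    Measure.lintegral_compProd hΨe, lintegral_map (Measurable.lintegral_kernel_prod_right' hΨe)
      (by fun_prop)]
  exact lintegral_congr fun y => lintegral_congr fun c' => hn y c'

/-- For a fixed chain, `J_n` involves only the clocks before `n`, hence is independent of the clock
`T_n`. -/
lemma lintegral_clocks_step (r : E → E → ℝ) (y : ℕ → Config E) (n : ℕ)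
    {G : ℝ≥0∞ × ℝ → ℝ≥0∞} (hG : Measurable G) :
    ∫⁻ u, G (jumpTime r n (y, u), u n) ∂clocks =
      ∫⁻ u, ∫⁻ τ, G (jumpTime r n (y, u), τ) ∂(expMeasure 1) ∂clocks := by
  have hi : iIndepFun (fun (i : ℕ) (u : ℕ → ℝ) => u i) clocks :=
    iIndepFun_infinitePi (X := fun _ => id) fun _ => measurable_id
  have hi' := hi.indepFun_finset (Finset.range n) {n} (by simp) (fun i => measurable_pi_apply i)
  let φ : (Finset.range n → ℝ) → ℝ≥0∞ := fun v =>
    ∑ k : Finset.range n, ENNReal.ofReal (v k) / totalRate r (y k)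
  let ψ : (({n} : Finset ℕ) → ℝ) → ℝ := fun v => v ⟨n, Finset.mem_singleton_self n⟩
  have hφ : Measurable φ := Finset.measurable_fun_sum _ fun k _ =>
    (ENNReal.measurable_ofReal.comp (measurable_pi_apply k)).div_const _
  have hψ : Measurable ψ := measurable_pi_apply _
  have hJ : (fun u : ℕ → ℝ => jumpTime r n (y, u)) = φ ∘ fun u i => u i := by
    ext u
    exact (Finset.sum_coe_sort (Finset.range n)
      (fun k => ENNReal.ofReal (u k) / totalRate r (y k))).symm
  have hJm : Measurable fun u : ℕ → ℝ => jumpTime r n (y, u) := by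
    rw [hJ]
    exact hφ.comp (measurable_pi_lambda _ fun i => measurable_pi_apply _)
  have hind : IndepFun (fun u : ℕ → ℝ => jumpTime r n (y, u)) (fun u : ℕ → ℝ => u n) clocks := by
    rw [hJ]
    exact hi'.comp hφ hψ
  have hmap := (indepFun_iff_map_prod_eq_prod_map_map hJm.aemeasurable
    (measurable_pi_apply n).aemeasurable).1 hind
  rw [Measure.infinitePi_map_eval] at hmap
  rw [← lintegral_map hG (hJm.prodMk (measurable_pi_apply n)), hmap,
    lintegral_prod _ hG.aemeasurable, lintegral_map (Measurable.lintegral_prod_right' hG) hJm]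

/-- One step of the jump chain together with its clock. -/
def stepKernel (r : E → E → ℝ) : Kernel (Config E × ℝ≥0∞) (ℝ × Config E) :=
  (Kernel.const _ (expMeasure 1)) ×ₖ ((jumpKernel r).comap Prod.fst measurable_fst)

instance (r : E → E → ℝ) : IsMarkovKernel (stepKernel r) := by
  unfold stepKernel
  infer_instance

lemma stepKernel_apply (r : E → E → ℝ) (z : Config E × ℝ≥0∞) :
    stepKernel r z = (expMeasure 1).prod (jumpProb r z.1) := by
  rw [stepKernel, Kernel.prod_apply, Kernel.const_apply, Kernel.comap_apply]
  rfl

/-- The state `(Y_n, J_n)`. -/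
def state (r : E → E → ℝ) (n : ℕ) (ω : Path E) : Config E × ℝ≥0∞ := (ω.1 n, jumpTime r n ω)

lemma measurable_state [Countable E] (r : E → E → ℝ) (n : ℕ) : Measurable (state r n) :=
  ((measurable_pi_apply n).comp measurable_fst).prodMk (measurable_jumpTime r n)

/-- The step `(T_n, Y_{n+1})`. -/
def nextStep (n : ℕ) (ω : Path E) : ℝ × Config E := (ω.2 n, ω.1 (n + 1))

lemma measurable_nextStep (n : ℕ) : Measurable (nextStep (E := E) n) :=
  ((measurable_pi_apply n).comp measurable_snd).prodMk
    ((measurable_pi_apply (n + 1)).comp measurable_fst)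

lemma lintegral_law_step [Countable E] (r : E → E → ℝ) (c : Config E) (n : ℕ)
    {f : (Config E × ℝ≥0∞) × (ℝ × Config E) → ℝ≥0∞} (hf : Measurable f) :
    ∫⁻ ω, f (state r n ω, nextStep n ω) ∂(law r c) =
      ∫⁻ ω, ∫⁻ p, f (state r n ω, p) ∂(stepKernel r (state r n ω)) ∂(law r c) := by
  have hm₁ : Measurable fun ω : Path E => f (state r n ω, nextStep n ω) :=
    hf.comp ((measurable_state r n).prodMk (measurable_nextStep n))
  have hm₂ : Measurable fun ω : Path E =>
      ∫⁻ p, f (state r n ω, p) ∂(stepKernel r (state r n ω)) :=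
    (Measurable.lintegral_kernel_prod_right' hf).comp (measurable_state r n)
  have hm₃ : Measurable fun ω : Path E =>
      ∫⁻ τ, f (state r n ω, (τ, ω.1 (n + 1))) ∂(expMeasure 1) := by
    refine Measurable.lintegral_prod_right'
      (f := fun q : Path E × ℝ => f (state r n q.1, (q.2, q.1.1 (n + 1)))) (hf.comp ?_)
    exact ((measurable_state r n).comp measurable_fst).prodMk (measurable_snd.prodMk
      ((measurable_pi_apply (n + 1)).comp (measurable_fst.comp measurable_fst)))
  rw [law, lintegral_prod _ hm₁.aemeasurable, lintegral_prod_symm _ hm₂.aemeasurable]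
  have h₁ : ∀ y : ℕ → Config E, ∫⁻ u, f (state r n (y, u), nextStep n (y, u)) ∂clocks =
      ∫⁻ u, ∫⁻ τ, f (state r n (y, u), (τ, y (n + 1))) ∂(expMeasure 1) ∂clocks := fun y =>
    lintegral_clocks_step r y n (G := fun q => f ((y n, q.1), (q.2, y (n + 1))))
      (hf.comp (by fun_prop))
  simp_rw [h₁]
  -- The clock `T_n` has been resampled for a fixed chain; after the swap, `Y_{n+1}` is resampled
  -- for fixed clocks.
  rw [lintegral_lintegral_swap (f := fun (y : ℕ → Config E) (u : ℕ → ℝ) =>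
    ∫⁻ τ, f (state r n (y, u), (τ, y (n + 1))) ∂(expMeasure 1)) hm₃.aemeasurable]
  refine lintegral_congr fun u => ?_
  have hmu : Measurable fun y : ℕ → Config E => state r n (y, u) :=
    (measurable_state r n).comp (measurable_id.prodMk measurable_const)
  have hms : Measurable (Function.uncurry fun (y : ℕ → Config E) (c' : Config E) =>
      ∫⁻ τ, f (state r n (y, u), (τ, c')) ∂(expMeasure 1)) := by
    refine Measurable.lintegral_prod_right' (f := fun q : ((ℕ → Config E) × Config E) × ℝ =>
      f (state r n (q.1.1, u), (q.2, q.1.2))) (hf.comp ?_)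
    exact (hmu.comp (measurable_fst.comp measurable_fst)).prodMk
      (measurable_snd.prodMk (measurable_snd.comp measurable_fst))
  rw [lintegral_chainLaw_step r c n hms]
  · refine lintegral_congr fun y => ?_
    have hfz : Measurable fun p => f (state r n (y, u), p) := hf.comp measurable_prodMk_left
    rw [stepKernel_apply, lintegral_prod_symm _ hfz.aemeasurable]
    rfl
  · intro y c'
    have : state r n (fun k => y (min k n), u) = state r n (y, u) := by
      refine Prod.ext (congrArg y (min_self n)) ?_
      simp only [state, jumpTime]
      refine Finset.sum_congr rfl fun k hk => ?_
      rw [min_eq_left (Finset.mem_range.1 hk).le]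
    simp only [this]

/-- The joint law of the state and of the next step. -/
theorem map_state_nextStep [Countable E] (r : E → E → ℝ) (c : Config E) (n : ℕ) :
    (law r c).map (fun ω => (state r n ω, nextStep n ω)) =
      ((law r c).map (state r n)) ⊗ₘ stepKernel r := by
  refine Measure.ext_of_lintegral _ fun f hf => ?_
  rw [lintegral_map hf ((measurable_state r n).prodMk (measurable_nextStep n)),
    lintegral_law_step r c n hf, Measure.lintegral_compProd hf,
    lintegral_map (Measurable.lintegral_kernel_prod_right' hf) (measurable_state r n)]

/-! ### The number of particles along the jump chain -/

lemma ae_chainLaw_zero [Countable E] (r : E → E → ℝ) (c : Config E) :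
    ∀ᵐ y ∂(chainLaw r c), y 0 = c := by
  have h : ∀ᵐ p ∂((chainLaw r c).map (Preorder.frestrictLe (π := fun _ => Config E) 0)),
      p ⟨0, Finset.mem_Iic.2 le_rfl⟩ = c := by
    have hm : Measurable fun p : (i : Finset.Iic 0) → Config E =>
      p ⟨0, Finset.mem_Iic.2 le_rfl⟩ := by fun_prop
    have hs : MeasurableSet {p : (i : Finset.Iic 0) → Config E |
      p ⟨0, Finset.mem_Iic.2 le_rfl⟩ = c} := hm (measurableSet_singleton c)
    rw [chainLaw, map_frestrictLe_zero_trajMeasure,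
      ae_map_iff (MeasurableEquiv.measurable _).aemeasurable hs,
      ae_dirac_iff (MeasurableSet.of_discrete)]
    rfl
  exact ae_of_ae_map (by fun_prop) h

lemma ae_law_zero [Countable E] (r : E → E → ℝ) (c : Config E) :
    ∀ᵐ ω ∂(law r c), ω.1 0 = c :=
  Measure.quasiMeasurePreserving_fst.ae (ae_chainLaw_zero r c)

lemma ae_card_succ_le [Countable E] (r : E → E → ℝ) (c : Config E) (n : ℕ) :
    ∀ᵐ ω ∂(law r c), card (ω.1 (n + 1)) ≤ card (ω.1 n) + 2 := by
  have hs : MeasurableSet {q : (Config E × ℝ≥0∞) × (ℝ × Config E) |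
      card q.2.2 ≤ card q.1.1 + 2} :=
    measurableSet_le ((Measurable.of_discrete (f := fun c : Config E => card c)).comp
      (measurable_snd.comp measurable_snd))
      ((Measurable.of_discrete (f := fun c : Config E => card c + 2)).comp
        (measurable_fst.comp measurable_fst))
  have h : ∀ᵐ q ∂((law r c).map (fun ω => (state r n ω, nextStep n ω))),
      card q.2.2 ≤ card q.1.1 + 2 := by
    rw [map_state_nextStep, Measure.ae_compProd_iff hs]
    refine ae_of_all _ fun z => ?_
    rw [stepKernel_apply]
    exact Measure.quasiMeasurePreserving_snd.ae (ae_jumpProb_card_le r z.1)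
  exact ae_of_ae_map ((measurable_state r n).prodMk (measurable_nextStep n)).aemeasurable h

lemma ae_card_le [Countable E] (r : E → E → ℝ) (c : Config E) :
    ∀ᵐ ω ∂(law r c), ∀ n, card (ω.1 n) ≤ card c + 2 * n := by
  filter_upwards [ae_law_zero r c, ae_all_iff.2 (ae_card_succ_le r c)] with ω h₀ hs n
  induction n with
  | zero => simp [h₀]
  | succ n ih => linarith [hs n]

/-! ### The tail of the jump times -/

lemma ae_clocks_pos : ∀ᵐ u ∂clocks, ∀ k, 0 < u k :=
  ae_all_iff.2 fun k =>
    (measurePreserving_eval_infinitePi (fun _ : ℕ => expMeasure 1) k).quasiMeasurePreserving.ae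
      ae_expMeasure_pos

/-- `u k / a` is exponential with rate `a`. -/
lemma mgf_clock_div {a l : ℝ} (ha : 0 < a) (hl : 0 ≤ l) (k : ℕ) :
    mgf (fun u : ℕ → ℝ => u k / a) clocks (-l) = a / (a + l) := by
  have hm : Measurable fun τ : ℝ => Real.exp (-l * (τ / a)) := by fun_prop
  have hneg : -(1 + l / a) < 0 := neg_lt_zero.2 (by positivity)
  calc mgf (fun u : ℕ → ℝ => u k / a) clocks (-l)
      = ∫ τ, Real.exp (-l * (τ / a)) ∂(clocks.map fun u => u k) := by
        rw [integral_map (φ := fun u : ℕ → ℝ => u k) (measurable_pi_apply k).aemeasurable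
          hm.aestronglyMeasurable, mgf]
    _ = ∫ τ in Set.Ioi 0, Real.exp (-(1 + l / a) * τ) := by
        rw [Measure.infinitePi_map_eval, integral_expMeasure]
        refine integral_congr_ae (ae_of_all _ fun τ => ?_)
        simp only [← Real.exp_add]
        congr 1
        ring
    _ = a / (a + l) := by
        rw [integral_exp_mul_Ioi hneg]
        field_simp
        simp

lemma integrable_exp_clock_div {a l : ℝ} (ha : 0 < a) (hl : 0 ≤ l) (k : ℕ) :
    Integrable (fun u : ℕ → ℝ => Real.exp (-l * (u k / a))) clocks := by
  have hm : Measurable fun u : ℕ → ℝ => Real.exp (-l * (u k / a)) := by fun_prop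
  refine Integrable.of_bound hm.aestronglyMeasurable 1 ?_
  filter_upwards [ae_clocks_pos] with u hu
  rw [Real.norm_eq_abs, Real.abs_exp, Real.exp_le_one_iff]
  have := hu k
  have h : 0 ≤ l * (u k / a) := by positivity
  linarith

/-- Chernoff's bound for a weighted sum of independent exponential clocks. -/
lemma clocks_sum_le (a : ℕ → ℝ) (ha : ∀ k, 0 < a k) {l : ℝ} (hl : 0 ≤ l) (t : ℝ) (n : ℕ) :
    clocks.real {u | ∑ k ∈ Finset.range n, u k / a k ≤ t} ≤
      Real.exp (l * t) * ∏ k ∈ Finset.range n, a k / (a k + l) := by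
  have hi : iIndepFun (fun (k : ℕ) (u : ℕ → ℝ) => u k / a k) clocks :=
    iIndepFun_infinitePi (X := fun k x => x / a k) fun k => by fun_prop
  have hm : ∀ k, Measurable fun u : ℕ → ℝ => u k / a k := fun k => by fun_prop
  have h := measure_le_le_exp_mul_mgf (μ := clocks) t (neg_nonpos.2 hl)
    (hi.integrable_exp_mul_sum hm (s := Finset.range n)
      fun k _ => integrable_exp_clock_div (ha k) hl k)
  rw [hi.mgf_sum hm, neg_neg] at h
  simp only [Finset.sum_apply, mgf_clock_div (ha _) hl] at h
  exact h

/-- A shift by `6` is three steps of length `2`, so the product telescopes to three factors over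
three, whence cubic decay. -/
lemma prod_div_add_six (m : ℝ) (hm : 0 < m) (n : ℕ) :
    ∏ k ∈ Finset.range n, (m + 2 * k) / (m + 2 * k + 6) =
      m * (m + 2) * (m + 4) / ((m + 2 * n) * (m + 2 * n + 2) * (m + 2 * n + 4)) := by
  induction n with
  | zero =>
    simp only [Finset.range_zero, Finset.prod_empty, Nat.cast_zero, mul_zero, add_zero]
    exact (div_self (by positivity)).symm
  | succ n ih =>
    rw [Finset.prod_range_succ, ih, Nat.cast_succ]
    field_simp
    ring

/-- The probability of at least `n` jumps before time `t` is of order `n ^ (-3)`. -/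
theorem exists_law_jumpTime_le [Countable E] {r : E → E → ℝ} (hr : BoundedRowSums r)
    (c : Config E) (t : ℝ≥0) :
    ∃ D, 0 ≤ D ∧ ∀ n : ℕ, (law r c).real {ω | jumpTime r n ω ≤ t} ≤ D / ((n : ℝ) + 1) ^ 3 := by
  -- The added ones, here and in `m`, keep the comparison rates `a k` positive even if `r = 0` or
  -- `c` is empty.
  set K : ℝ := rowBound r + 1 with hK
  have hb : 0 ≤ rowBound r := ENNReal.toReal_nonneg
  have hKpos : 0 < K := by linarith
  set m : ℝ := card c + 1 with hm
  have hm0 : 0 < m := by positivity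
  set a : ℕ → ℝ := fun k => K * (m + 2 * k) with ha
  have ha0 : ∀ k, 0 < a k := fun k => by positivity
  refine ⟨Real.exp (6 * K * t) * (m * (m + 2) * (m + 4)), by positivity, fun n => ?_⟩
  have hsub : (law r c).real {ω | jumpTime r n ω ≤ t} ≤
      (law r c).real (Prod.snd ⁻¹' {u | ∑ k ∈ Finset.range n, u k / a k ≤ t}) := by
    refine ENNReal.toReal_mono (measure_ne_top _ _) (measure_mono_ae ?_)
    filter_upwards [ae_card_le r c, Measure.quasiMeasurePreserving_snd.ae ae_clocks_pos]
      with ω hcard hpos hω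
    have hω' : jumpTime r n ω ≤ t := hω
    change ∑ k ∈ Finset.range n, ω.2 k / a k ≤ t
    have h : ENNReal.ofReal (∑ k ∈ Finset.range n, ω.2 k / a k) ≤ t := by
      refine le_trans ?_ hω'
      rw [ENNReal.ofReal_sum_of_nonneg fun k _ => div_nonneg (hpos k).le (ha0 k).le]
      refine Finset.sum_le_sum fun k _ => ?_
      rw [ENNReal.ofReal_div_of_pos (ha0 k)]
      refine ENNReal.div_le_div_left ((totalRate_le hr _).trans ?_) _
      rw [← ENNReal.ofReal_natCast, ← ENNReal.ofReal_mul hb]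
      refine ENNReal.ofReal_le_ofReal ?_
      have : ((card (ω.1 k) : ℕ) : ℝ) ≤ card c + 2 * k := by exact_mod_cast hcard k
      exact mul_le_mul (by linarith) (by linarith) (by positivity) hKpos.le
    rw [← ENNReal.ofReal_coe_nnreal] at h
    exact (ENNReal.ofReal_le_ofReal_iff t.2).1 h
  have hsnd : (law r c).real (Prod.snd ⁻¹' {u | ∑ k ∈ Finset.range n, u k / a k ≤ t}) =
      clocks.real {u | ∑ k ∈ Finset.range n, u k / a k ≤ t} := by
    have hs : MeasurableSet {u : ℕ → ℝ | ∑ k ∈ Finset.range n, u k / a k ≤ t} :=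
      measurableSet_le (by fun_prop) measurable_const
    exact (measurePreserving_snd (μ := chainLaw r c) (ν := clocks)).measureReal_preimage
      hs.nullMeasurableSet
  rw [hsnd] at hsub
  -- With `l = 6 * K` the factor `K` cancels and the telescoping product appears.
  refine hsub.trans ((clocks_sum_le a ha0 (l := 6 * K) (by positivity) t n).trans ?_)
  have hprod : ∏ k ∈ Finset.range n, a k / (a k + 6 * K) =
      ∏ k ∈ Finset.range n, (m + 2 * k) / (m + 2 * k + 6) :=
    Finset.prod_congr rfl fun k _ => by
      rw [ha, ← mul_div_mul_left _ (m + 2 * (k : ℝ) + 6) hKpos.ne']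
      ring
  rw [hprod, prod_div_add_six m hm0, mul_div_assoc (Real.exp _)]
  refine mul_le_mul_of_nonneg_left ?_ (Real.exp_nonneg _)
  refine div_le_div_of_nonneg_left (by positivity) (by positivity) ?_
  have h1 : (n : ℝ) + 1 ≤ m + 2 * n := by
    have : (0 : ℝ) ≤ card c := by positivity
    have : (0 : ℝ) ≤ n := by positivity
    linarith
  rw [show ((n : ℝ) + 1) ^ 3 = ((n : ℝ) + 1) * ((n : ℝ) + 1) * ((n : ℝ) + 1) by ring]
  have h0 : (0 : ℝ) ≤ (n : ℝ) + 1 := by positivity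
  exact mul_le_mul (mul_le_mul h1 (by linarith) h0 (h0.trans h1)) (by linarith) h0
    (mul_nonneg (h0.trans h1) (by linarith))

/-- The system does not explode. -/
theorem ae_exists_lt_jumpTime [Countable E] {r : E → E → ℝ} (hr : BoundedRowSums r)
    (c : Config E) : ∀ᵐ ω ∂(law r c), ∀ t : ℝ≥0, ∃ n : ℕ, (t : ℝ≥0∞) < jumpTime r n ω := by
  -- Integer times suffice, which leaves countably many null sets.
  have h : ∀ N : ℕ, ∀ᵐ ω ∂(law r c), ∃ n : ℕ, ((N : ℝ≥0) : ℝ≥0∞) < jumpTime r n ω := by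
    intro N
    obtain ⟨D, -, hD⟩ := exists_law_jumpTime_le hr c (N : ℝ≥0)
    rw [ae_iff]
    push Not
    rw [← measureReal_eq_zero_iff]
    refine le_antisymm (ge_of_tendsto' (x := Filter.atTop) (f := fun n : ℕ => D / ((n : ℝ) + 1) ^ 3)
      ?_ fun n => (measureReal_mono ?_).trans (hD n)) measureReal_nonneg
    swap
    · exact fun ω (hω : ∀ n, jumpTime r n ω ≤ _) => hω n
    exact Filter.Tendsto.const_div_atTop ((Filter.tendsto_pow_atTop three_ne_zero).comp
      (Filter.tendsto_atTop_add_const_right _ _ tendsto_natCast_atTop_atTop)) D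
  filter_upwards [ae_all_iff.2 h] with ω hω t
  obtain ⟨N, hN⟩ := exists_nat_ge t
  obtain ⟨n, hn⟩ := hω N
  exact ⟨n, (ENNReal.coe_le_coe.2 hN).trans_lt hn⟩

/-! ### The stochastic representation -/

/-- The common `L¹` bound for `remaining` and `realized`: both vanish unless `J_n ≤ t`, and there
the population is at most `card c + 2 * n`. -/
lemma integrable_of_card_bound [Countable E] (r : E → E → ℝ) (c : Config E) (t : ℝ≥0) {C : ℝ}
    {n : ℕ} {G : Path E → ℝ} (hG : Measurable G) (hC : 0 ≤ C)
    (hle : ∀ ω, |G ω| ≤ C * card (ω.1 n)) (h₀ : ∀ ω, ¬ jumpTime r n ω ≤ t → G ω = 0) :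
    Integrable G (law r c) ∧ ∫ ω, ‖G ω‖ ∂(law r c) ≤
      C * (card c + 2 * n) * (law r c).real {ω | jumpTime r n ω ≤ t} := by
  have hs : MeasurableSet {ω : Path E | jumpTime r n ω ≤ t} :=
    measurableSet_le (measurable_jumpTime r n) measurable_const
  have hb : ∀ᵐ ω ∂(law r c), ‖G ω‖ ≤
      {ω : Path E | jumpTime r n ω ≤ t}.indicator (fun _ => C * (card c + 2 * n : ℝ)) ω := by
    filter_upwards [ae_card_le r c] with ω hω
    by_cases h : jumpTime r n ω ≤ t
    · rw [Set.indicator_of_mem (show ω ∈ {ω : Path E | jumpTime r n ω ≤ t} from h)]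
      refine (hle ω).trans (mul_le_mul_of_nonneg_left ?_ hC)
      exact_mod_cast hω n
    · rw [Set.indicator_of_notMem (show ω ∉ {ω : Path E | jumpTime r n ω ≤ t} from h), h₀ ω h,
        norm_zero]
  have hi : Integrable ({ω : Path E | jumpTime r n ω ≤ t}.indicator
      (fun _ => C * (card c + 2 * n : ℝ))) (law r c) := (integrable_const _).indicator hs
  refine ⟨hi.mono' hG.aestronglyMeasurable hb, ?_⟩
  refine (integral_mono_ae (hi.mono' hG.aestronglyMeasurable hb).norm hi hb).trans ?_
  rw [integral_indicator_const _ hs, smul_eq_mul, mul_comm]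

variable (r : E → E → ℝ) (hr : BoundedRowSums r) (f : BddFun E) (t : ℝ≥0)

lemma measurable_remaining [Countable E] :
    Measurable fun z : Config E × ℝ≥0∞ => remaining r hr f t z.1 z.2 := by
  refine measurable_from_prod_countable_right fun c => ?_
  unfold remaining
  refine Measurable.ite measurableSet_Iic ?_ measurable_const
  exact (continuous_value r hr f c).measurable.comp
    (measurable_const.sub ENNReal.measurable_toReal)

lemma measurable_realized [Countable E] :
    Measurable fun q : Config E × (ℝ≥0∞ × ℝ≥0∞) => realized f t q.1 q.2.1 q.2.2 := by
  refine measurable_from_prod_countable_right fun c => ?_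
  simp only [realized]
  exact Measurable.ite ((measurableSet_le measurable_fst measurable_const).inter
    (measurableSet_lt measurable_const measurable_snd)) measurable_const measurable_const

lemma exists_abs_remaining_le : ∃ C, 0 ≤ C ∧ (∀ c j, |remaining r hr f t c j| ≤ C * card c) ∧
    ∀ c j j', |realized f t c j j'| ≤ C * card c := by
  obtain ⟨C, hC, h⟩ := exists_norm_evol_le r hr f t
  refine ⟨C, hC, fun c j => ?_, fun c j j' => ?_⟩
  · unfold remaining
    split_ifs with hj
    · have hj' : j.toReal ≤ t := by
        simpa using ENNReal.toReal_mono ENNReal.coe_ne_top hj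
      exact abs_lift_le (fun x => (BddFun.abs_apply_le _ x).trans
        (h _ ⟨sub_nonneg.2 hj', sub_le_self _ ENNReal.toReal_nonneg⟩)) c
    · rw [abs_zero]
      positivity
  · unfold realized
    split_ifs
    · have h0 := h 0 ⟨le_rfl, t.2⟩
      rw [evol_zero] at h0
      exact abs_lift_le (fun x => (BddFun.abs_apply_le f x).trans h0) c
    · rw [abs_zero]
      positivity

/-- The time of the next jump. -/
def nextTime (z : Config E × ℝ≥0∞) (τ : ℝ) : ℝ≥0∞ := z.2 + ENNReal.ofReal τ / totalRate r z.1

lemma measurable_nextTime [Countable E] :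
    Measurable fun q : (Config E × ℝ≥0∞) × ℝ => nextTime r q.1 q.2 := by
  have h₁ : Measurable fun q : (Config E × ℝ≥0∞) × ℝ => totalRate r q.1.1 :=
    (measurable_totalRate r).comp (measurable_fst.comp measurable_fst)
  have h₂ : Measurable fun q : (Config E × ℝ≥0∞) × ℝ => ENNReal.ofReal q.2 :=
    ENNReal.measurable_ofReal.comp measurable_snd
  exact (measurable_snd.comp measurable_fst).add (h₂.div h₁)

/-- The contribution of one step to the mean value. -/
def stepValue (q : (Config E × ℝ≥0∞) × (ℝ × Config E)) : ℝ :=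
  realized f t q.1.1 q.1.2 (nextTime r q.1 q.2.1) +
    remaining r hr f t q.2.2 (nextTime r q.1 q.2.1)

lemma measurable_stepValue [Countable E] : Measurable (stepValue r hr f t) := by
  have hn : Measurable fun q : (Config E × ℝ≥0∞) × (ℝ × Config E) => nextTime r q.1 q.2.1 :=
    (measurable_nextTime r).comp (measurable_fst.prodMk (measurable_fst.comp measurable_snd))
  exact ((measurable_realized f t).comp ((measurable_fst.comp measurable_fst).prodMk
    ((measurable_snd.comp measurable_fst).prodMk hn))).add
    ((measurable_remaining r hr f t).comp ((measurable_snd.comp measurable_snd).prodMk hn))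

/-- Clock and jump are independent under `stepKernel`, so Fubini reduces this to
`remaining_eq_integral`. -/
lemma integral_stepKernel_stepValue [Countable E] (z : Config E × ℝ≥0∞) :
    ∫ p, stepValue r hr f t (z, p) ∂(stepKernel r z) = remaining r hr f t z.1 z.2 := by
  obtain ⟨C, hC, hrem, hreal⟩ := exists_abs_remaining_le r hr f t
  have hint : Integrable (fun p => stepValue r hr f t (z, p))
      ((expMeasure 1).prod (jumpProb r z.1)) := by
    refine Integrable.of_bound
      ((measurable_stepValue r hr f t).comp measurable_prodMk_left).aestronglyMeasurable
      (C * card z.1 + C * (card z.1 + 2 : ℕ)) ?_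
    filter_upwards [Measure.quasiMeasurePreserving_snd.ae (ae_jumpProb_card_le r z.1)] with p hp
    refine (abs_add_le _ _).trans (add_le_add (hreal _ _ _) ((hrem _ _).trans ?_))
    gcongr
  rw [stepKernel_apply, integral_prod _ hint, remaining_eq_integral]
  refine integral_congr_ae (ae_of_all _ fun τ => ?_)
  have hi : Integrable (fun c' => remaining r hr f t c' (nextTime r z τ)) (jumpProb r z.1) := by
    refine Integrable.of_bound Measurable.of_discrete.aestronglyMeasurable
      (C * (card z.1 + 2 : ℕ)) ?_
    filter_upwards [ae_jumpProb_card_le r z.1] with c' hc'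
    refine (hrem _ _).trans ?_
    gcongr
  simp only [stepValue]
  rw [integral_add (integrable_const _) hi]
  simp [nextTime]

lemma measurable_remaining_state [Countable E] (n : ℕ) :
    Measurable fun ω : Path E => remaining r hr f t (ω.1 n) (jumpTime r n ω) :=
  (measurable_remaining r hr f t).comp (measurable_state r n)

lemma measurable_realized_state [Countable E] (n : ℕ) : Measurable fun ω : Path E =>
    realized f t (ω.1 n) (jumpTime r n ω) (jumpTime r (n + 1) ω) :=
  (measurable_realized f t).comp (((measurable_pi_apply n).comp measurable_fst).prodMk
    ((measurable_jumpTime r n).prodMk (measurable_jumpTime r (n + 1))))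

lemma remaining_state_bound [Countable E] (c : Config E) : ∃ C, 0 ≤ C ∧
    (∀ n, Integrable (fun ω => remaining r hr f t (ω.1 n) (jumpTime r n ω)) (law r c) ∧
      ∫ ω, ‖remaining r hr f t (ω.1 n) (jumpTime r n ω)‖ ∂(law r c) ≤
        C * (1 / ((n : ℝ) + 1) ^ 2)) ∧
    ∀ n, Integrable (fun ω => realized f t (ω.1 n) (jumpTime r n ω) (jumpTime r (n + 1) ω))
        (law r c) ∧
      ∫ ω, ‖realized f t (ω.1 n) (jumpTime r n ω) (jumpTime r (n + 1) ω)‖ ∂(law r c) ≤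
        C * (1 / ((n : ℝ) + 1) ^ 2) := by
  obtain ⟨C, hC, hrem, hreal⟩ := exists_abs_remaining_le r hr f t
  obtain ⟨D, hD, hP⟩ := exists_law_jumpTime_le hr c t
  have key : ∀ n : ℕ, C * (card c + 2 * n) * (law r c).real {ω | jumpTime r n ω ≤ t} ≤
      C * (card c + 2) * D * (1 / ((n : ℝ) + 1) ^ 2) := fun n => by
    have h1 : (card c : ℝ) + 2 * n ≤ (card c + 2) * (n + 1) := by
      have : (0 : ℝ) ≤ card c * n := by positivity
      linarith
    calc C * (card c + 2 * n) * (law r c).real {ω | jumpTime r n ω ≤ t}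
        ≤ C * ((card c + 2) * (n + 1)) * (D / ((n : ℝ) + 1) ^ 3) := by
          gcongr
          exact hP n
      _ = _ := by field_simp
  refine ⟨C * (card c + 2) * D, by positivity, fun n => ?_, fun n => ?_⟩
  · have h := integrable_of_card_bound r c t (n := n) (measurable_remaining_state r hr f t n) hC
      (fun ω => hrem _ _) fun ω hω => if_neg hω
    exact ⟨h.1, h.2.trans (key n)⟩
  · have h := integrable_of_card_bound r c t (n := n) (measurable_realized_state r f t n) hC
      (fun ω => hreal _ _ _) fun ω hω => if_neg fun h' => hω h'.1
    exact ⟨h.1, h.2.trans (key n)⟩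

/-- The mean remaining value changes by the mean of what is realized before the next jump. -/
lemma integral_remaining_step [Countable E] (c : Config E) (n : ℕ) :
    ∫ ω, remaining r hr f t (ω.1 n) (jumpTime r n ω) ∂(law r c) =
      ∫ ω, realized f t (ω.1 n) (jumpTime r n ω) (jumpTime r (n + 1) ω) ∂(law r c) +
        ∫ ω, remaining r hr f t (ω.1 (n + 1)) (jumpTime r (n + 1) ω) ∂(law r c) := by
  obtain ⟨C, -, hrem, hreal⟩ := remaining_state_bound r hr f t c
  have hpair := (measurable_state r n).prodMk (measurable_nextStep (E := E) n)
  have hval : ∀ ω : Path E, stepValue r hr f t (state r n ω, nextStep n ω) =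
      realized f t (ω.1 n) (jumpTime r n ω) (jumpTime r (n + 1) ω) +
        remaining r hr f t (ω.1 (n + 1)) (jumpTime r (n + 1) ω) := fun ω => by
    rw [jumpTime_succ]
    rfl
  have hint : Integrable (stepValue r hr f t)
      (((law r c).map (state r n)) ⊗ₘ stepKernel r) := by
    rw [← map_state_nextStep,
      integrable_map_measure (measurable_stepValue r hr f t).aestronglyMeasurable
        hpair.aemeasurable]
    exact ((hreal n).1.add (hrem (n + 1)).1).congr (ae_of_all _ fun ω => (hval ω).symm)
  rw [← integral_add (hreal n).1 (hrem (n + 1)).1, ← integral_congr_ae (ae_of_all _ hval),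
    ← integral_map (φ := fun ω => (state r n ω, nextStep n ω)) hpair.aemeasurable
      (measurable_stepValue r hr f t).aestronglyMeasurable, map_state_nextStep,
    Measure.integral_compProd hint]
  simp_rw [integral_stepKernel_stepValue]
  rw [integral_map (measurable_state r n).aemeasurable
    (measurable_remaining r hr f t).aestronglyMeasurable]
  rfl

/-- Until the explosion, the configuration at time `t` is `Y_n` for the one `n` with
`J_n ≤ t < J_{n+1}`. -/
lemma hasSum_realized {ω : Path E} (hω : ∃ n : ℕ, (t : ℝ≥0∞) < jumpTime r n ω) :
    HasSum (fun n => realized f t (ω.1 n) (jumpTime r n ω) (jumpTime r (n + 1) ω))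
      (lift f (config r t ω)) := by
  classical
  have h : ∃ n, (t : ℝ≥0∞) < jumpTime r (n + 1) ω := by
    obtain ⟨n, hn⟩ := hω
    exact ⟨n, hn.trans_le (jumpTime_mono r ω n.le_succ)⟩
  have hc : config r t ω = ω.1 (Nat.find h) := by
    rw [config, dif_pos h]
  have hiff : ∀ n, (jumpTime r n ω ≤ t ∧ (t : ℝ≥0∞) < jumpTime r (n + 1) ω) ↔ n = Nat.find h := by
    refine fun n => ⟨fun hn => ?_, fun hn => ?_⟩
    · refine le_antisymm (not_lt.1 fun hlt => ?_) (Nat.find_min' h hn.2)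
      exact ((Nat.find_spec h).trans_le ((jumpTime_mono r ω hlt).trans hn.1)).false
    · subst hn
      refine ⟨?_, Nat.find_spec h⟩
      rcases hk : Nat.find h with _ | k
      -- `J_0` is an empty sum, hence zero.
      · simp [jumpTime]
      · exact not_lt.1 (Nat.find_min h (hk ▸ k.lt_succ_self))
  rw [hc]
  have hs : realized f t (ω.1 (Nat.find h)) (jumpTime r (Nat.find h) ω)
      (jumpTime r (Nat.find h + 1) ω) = lift f (ω.1 (Nat.find h)) := if_pos ((hiff _).2 rfl)
  rw [← hs]
  exact hasSum_single _ fun n hn => if_neg ((hiff n).not.2 hn)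

/-- The stochastic representation of the semigroup, from any initial configuration. -/
theorem lift_config_integral [Countable E] (c : Config E) :
    Integrable (fun ω => lift f (config r t ω)) (law r c) ∧
      lift (semigroup r hr t f) c = ∫ ω, lift f (config r t ω) ∂(law r c) := by
  obtain ⟨C, hC, hrem, hreal⟩ := remaining_state_bound r hr f t c
  set F : ℕ → Path E → ℝ := fun n ω =>
    realized f t (ω.1 n) (jumpTime r n ω) (jumpTime r (n + 1) ω) with hF
  have hsq : Summable fun n : ℕ => C * (1 / ((n : ℝ) + 1) ^ 2) := by
    refine Summable.mul_left _ ?_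
    have := (summable_nat_add_iff 1).2 (Real.summable_one_div_nat_pow.2 one_lt_two)
    simpa using this
  have hsum : Summable fun n => ∫ ω, ‖F n ω‖ ∂(law r c) :=
    hsq.of_nonneg_of_le (fun n => integral_nonneg fun ω => norm_nonneg _) fun n => (hreal n).2
  have hae : ∀ᵐ ω ∂(law r c), HasSum (fun n => F n ω) (lift f (config r t ω)) := by
    filter_upwards [ae_exists_lt_jumpTime hr c] with ω hω
    exact hasSum_realized r f t (hω t)
  have hts : (fun ω => ∑' n, F n ω) =ᵐ[law r c] fun ω => lift f (config r t ω) := by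
    filter_upwards [hae] with ω hω
    exact hω.tsum_eq
  have hint : HasSum (fun n => ∫ ω, F n ω ∂(law r c)) (∫ ω, lift f (config r t ω) ∂(law r c)) := by
    rw [← integral_congr_ae hts]
    exact hasSum_integral_of_summable_integral_norm (fun n => (hreal n).1) hsum
  refine ⟨?_, ?_⟩
  -- Measurability comes from the a.e. limit of the partial sums, finiteness from the summable `L¹`
  -- norms.
  · refine ⟨aestronglyMeasurable_of_tendsto_ae Filter.atTop
      (fun n => Finset.aestronglyMeasurable_fun_sum (Finset.range n)
        fun k _ => (hreal k).1.aestronglyMeasurable) ?_, ?_⟩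
    · filter_upwards [hae] with ω hω
      exact hω.tendsto_sum_nat
    · refine (lintegral_mono_ae (g := fun ω => ∑' n, ‖F n ω‖ₑ) ?_).trans_lt ?_
      · filter_upwards [hae] with ω hω
        rw [← hω.tsum_eq]
        exact enorm_tsum_le_tsum_enorm
      · rw [lintegral_tsum fun n => (hreal n).1.aestronglyMeasurable.enorm]
        simp_rw [← ofReal_integral_norm_eq_lintegral_enorm (hreal _).1]
        exact hsum.tsum_ofReal_lt_top
  have hstart : ∫ ω, remaining r hr f t (ω.1 0) (jumpTime r 0 ω) ∂(law r c) =
      lift (semigroup r hr t f) c := by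
    have : (fun ω => remaining r hr f t (ω.1 0) (jumpTime r 0 ω)) =ᵐ[law r c]
        fun _ => lift (semigroup r hr t f) c := by
      filter_upwards [ae_law_zero r c] with ω hω
      rw [hω]
      simp [remaining, jumpTime, value, evol, semigroup]
    rw [integral_congr_ae this]
    simp
  -- The one-step identities telescope, leaving a remainder that tends to zero.
  have hpart : ∀ n, ∑ k ∈ Finset.range n, ∫ ω, F k ω ∂(law r c) = lift (semigroup r hr t f) c -
      ∫ ω, remaining r hr f t (ω.1 n) (jumpTime r n ω) ∂(law r c) := fun n => by
    induction n with
    | zero => rw [hstart]; simp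
    | succ n ih =>
      rw [Finset.sum_range_succ, ih, integral_remaining_step r hr f t c n]
      ring
  have hzero : Filter.Tendsto (fun n => ∫ ω, remaining r hr f t (ω.1 n) (jumpTime r n ω) ∂(law r c))
      Filter.atTop (nhds 0) :=
    squeeze_zero_norm (fun n => (norm_integral_le_integral_norm _).trans (hrem n).2)
      hsq.tendsto_atTop_zero
  have hlim := (hzero.const_sub (lift (semigroup r hr t f) c)).congr fun n => (hpart n).symm
  rw [sub_zero] at hlim
  exact tendsto_nhds_unique hlim hint.tendsto_sum_nat

lemma lift_single (g : E → ℝ) (x : E) : lift g ⟨δ x, 0⟩ = g x := by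
  rw [lift_eq_weight, map_zero, sub_zero, Finsupp.weight_single, one_smul]

end SignedRates

end

theorem theorem2 {E : Type*} [Countable E] (r : E → E → ℝ)
    (hr : SignedRates.BoundedRowSums r) :
    -- the system does not explode
    (∀ c : SignedRates.Config E, ∀ᵐ ω ∂(SignedRates.law r c),
      ∀ t : ℝ≥0, ∃ n : ℕ, (t : ℝ≥0∞) < SignedRates.jumpTime r n ω) ∧
    -- the stochastic description of the semigroup
    ∀ (f : SignedRates.BddFun E) (t : ℝ≥0) (x : E),
      Integrable (fun ω => SignedRates.lift f (SignedRates.config r t ω))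
        (SignedRates.law r ⟨SignedRates.δ x, 0⟩) ∧
      SignedRates.semigroup r hr t f x =
        ∫ ω, SignedRates.lift f (SignedRates.config r t ω)
          ∂(SignedRates.law r ⟨SignedRates.δ x, 0⟩) :=
  ⟨SignedRates.ae_exists_lt_jumpTime hr, fun f t x => by
    have h := SignedRates.lift_config_integral r hr f t ⟨SignedRates.δ x, 0⟩
    rw [SignedRates.lift_single] at h
    exact h⟩
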